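/- Let $G$ be a finite abelian group (written additively) with $|G|\ge 3$, exponent $n$ and rank $r$; that is, $G\cong C_{n_1}\oplus\cdots\oplus C_{n_r}$ with $1<n_1\mid\cdots\mid n_r=n$ (equivalently, $r$ is the minimal number of generators of $G$). For a subset $G_0\subset G$, let $\mathcal B(G_0)$ be the monoid of zero-sum sequences over $G_0$, i.e. of all finite unordered sequences $S=g_1\cdots g_l$ of elements of $G_0$, repetition allowed, with $g_1+\cdots+g_l=0$; the operation is concatenation. For $B\in\mathcal B(G_0)$ let $\mathsf L(B)$ be the set of all $k$ such that $B$ is a product of $k$ atoms (irreducible elements) of $\mathcal B(G_0)$. Let $\Delta(G_0)$ be the set of all $b-a$ for which there is $B\in\mathcal B(G_0)$ with $a,b\in\mathsf L(B)$, $a<b$, and $[a,b]\cap\mathsf L(B)=\{a,b\}$. The set $G_0$ is non-half-factorial if $\Delta(G_0)\neq\emptyset$, and it is an LCN-set if every atom $A=g_1\cdots g_l$ of $\mathcal B(G_0)$ satisfies $\sum_{i=1}^l \frac1{\operatorname{ord}(g_i)}\ge 1$. Set $$\mathsf m(G)=\max\{\min\Delta(G_0)\mid G_0\subset G\text{ is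 an LCN-set with }\Delta(G_0)\ne\emptyset\},$$ where $\max\emptyset=0$. Then $$\mathsf m(G)\le\max\Big\{r-1,\ \Big\lfloor\frac n2\Big\rfloor-1\Big\}.$$ -/

import Mathlib

namespace ZeroSumTheory

/-- The set of (successive) distances of a set `L` of nonnegative integers: all `d = b - a` with
`a < b` in `L` and `[a, b] ∩ L = {a, b}`. -/
def distances (L : Set ℕ) : Set ℕ :=
  {d | ∃ a ∈ L, ∃ b ∈ L, a < b ∧ Set.Icc a b ∩ L = {a, b} ∧ d = b - a}

/-- The set of lengths of `a` in a commutative monoid written additively: all `k` such that `a` is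
a sum of `k` atoms. -/
def lengthSet {M : Type*} [AddCommMonoid M] (a : M) : Set ℕ :=
  {k | ∃ s : Multiset M, (∀ u ∈ s, AddIrreducible u) ∧ s.sum = a ∧ s.card = k}

/-- The set of distances of a commutative monoid: the union of the sets of distances of all its
sets of lengths. -/
def monoidDistances (M : Type*) [AddCommMonoid M] : Set ℕ :=
  ⋃ a : M, distances (lengthSet a)

/-- The monoid of zero-sum sequences over `G₀`. Sequences over `G₀` (elements of the free abelian
monoid with basis `G₀`) are multisets with all elements in `G₀`; their product is the sum of
multisets. -/
def zeroSumMonoid {G : Type*} [AddCommGroup G] (G₀ : Set G) : AddSubmonoid (Multiset G) where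
  carrier := {S | (∀ g ∈ S, g ∈ G₀) ∧ S.sum = 0}
  zero_mem' := by simp
  add_mem' := by
    rintro S T ⟨hS, hS'⟩ ⟨hT, hT'⟩
    refine ⟨fun g hg => ?_, by simp [hS', hT']⟩
    rcases Multiset.mem_add.1 hg with h | h
    exacts [hS g h, hT g h]

/-- `Δ(G₀)`, the set of distances of the monoid of zero-sum sequences over `G₀`. -/
def setDistances {G : Type*} [AddCommGroup G] (G₀ : Set G) : Set ℕ :=
  monoidDistances (zeroSumMonoid G₀)

/-- The cross number of a sequence `S = g₁ ⋯ g_l`: the sum of the `1 / ord (g_i)`. -/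
noncomputable def crossNumber {G : Type*} [AddCommGroup G] (S : Multiset G) : ℚ :=
  (S.map fun g => 1 / (addOrderOf g : ℚ)).sum

/-- `G₀` is an LCN-set (large cross number) if every atom of the monoid of zero-sum sequences over
`G₀` has cross number at least `1`. -/
def IsLCN {G : Type*} [AddCommGroup G] (G₀ : Set G) : Prop :=
  ∀ A : zeroSumMonoid G₀, AddIrreducible A → 1 ≤ crossNumber (A : Multiset G)

/-- The values `min Δ(G₀)`, where `G₀` runs over the LCN-subsets of `G` with `Δ(G₀) ≠ ∅`. -/
def lcnMinDistances (G : Type*) [AddCommGroup G] : Set ℕ :=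
  {d | ∃ G₀ : Set G, IsLCN G₀ ∧ (setDistances G₀).Nonempty ∧ d = sInf (setDistances G₀)}

/-- `m(G)`, the maximum of `lcnMinDistances G`, with the convention `max ∅ = 0`. -/
noncomputable def m (G : Type*) [AddCommGroup G] : ℕ :=
  sSup (lcnMinDistances G)

/-- For finite `G` the supremum defining `m G` is a maximum over a finite set. -/
theorem lcnMinDistances_finite (G : Type*) [AddCommGroup G] [Finite G] :
    (lcnMinDistances G).Finite :=
  (Set.finite_range fun G₀ : Set G => sInf (setDistances G₀)).subset <| by
    rintro d ⟨G₀, -, -, rfl⟩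
    exact ⟨G₀, rfl⟩

theorem isGreatest_m (G : Type*) [AddCommGroup G] [Finite G]
    (h : (lcnMinDistances G).Nonempty) : IsGreatest (lcnMinDistances G) (m G) :=
  ⟨Nat.sSup_mem h (lcnMinDistances_finite G).bddAbove,
    fun _ hd => le_csSup (lcnMinDistances_finite G).bddAbove hd⟩

/-- `AddGroup.rank`, the minimal number of generators, is the rank of a finite abelian group in the
sense of invariant factors: it is `r` if `G ≅ C_{n₁} ⊕ ⋯ ⊕ C_{n_r}` with `1 < n₁ ∣ ⋯ ∣ n_r`. -/
theorem rank_eq_of_invariantFactors (G : Type*) [AddCommGroup G] [Finite G] (r : ℕ) (c : Fin r → ℕ)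
    (hc : ∀ i, 1 < c i) (hdvd : ∀ i j, i ≤ j → c i ∣ c j) (e : G ≃+ (∀ i, ZMod (c i))) :
    AddGroup.rank G = r := by
  classical
  apply le_antisymm
  · let b : Fin r → G := fun i => e.symm (Pi.single i 1)
    have hb : AddSubgroup.closure ((Finset.univ.image b : Finset G) : Set G) = ⊤ := by
      rw [eq_top_iff]
      intro g _
      have hg : g = ∑ i, (ZMod.cast (e g i) : ℤ) • b i := by
        apply e.injective
        rw [map_sum]
        funext j
        rw [Finset.sum_apply, Finset.sum_eq_single j]
        · simp [b]
        · intro i _ hij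
          simp [b, Pi.single_eq_of_ne hij.symm]
        · simp
      rw [hg]
      refine AddSubgroup.sum_mem _ fun i _ => AddSubgroup.zsmul_mem _ ?_ _
      exact AddSubgroup.subset_closure (by simp)
    exact (AddGroup.rank_le hb).trans (Finset.card_image_le.trans (by simp))
  · rcases Nat.eq_zero_or_pos r with rfl | hr
    · exact Nat.zero_le _
    obtain ⟨p, hp, hp0⟩ := Nat.exists_prime_and_dvd (hc ⟨0, hr⟩).ne'
    have : Fact p.Prime := ⟨hp⟩
    have hpi : ∀ i, p ∣ c i := fun i => hp0.trans (hdvd _ _ (Nat.zero_le _))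
    let f : G → (Fin r → ZMod p) := fun g i => ZMod.castHom (hpi i) (ZMod p) (e g i)
    let φ : G →+ (Fin r → ZMod p) :=
      { toFun := f
        map_zero' := by funext i; simp [f]
        map_add' := by intro x y; funext i; simp only [f, map_add, Pi.add_apply] }
    have hφ : Function.Surjective φ := by
      intro y
      choose x hx using fun i => ZMod.castHom_surjective (hpi i) (y i)
      exact ⟨e.symm x, by funext i; simpa [φ, f] using hx i⟩
    obtain ⟨S, hS, hSt⟩ := AddGroup.rank_spec G
    have hspan : Submodule.span (ZMod p) ((S.image φ : Finset _) : Set (Fin r → ZMod p)) = ⊤ := by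
      rw [eq_top_iff]
      intro y _
      obtain ⟨g, rfl⟩ := hφ y
      have hg : g ∈ AddSubgroup.closure (S : Set G) := by rw [hSt]; trivial
      induction hg using AddSubgroup.closure_induction with
      | mem x hx => exact Submodule.subset_span (by simpa using ⟨x, hx, rfl⟩)
      | zero => simp
      | add x y _ _ hx hy => rw [map_add]; exact Submodule.add_mem _ (hx trivial) (hy trivial)
      | neg x _ hx => rw [map_neg]; exact Submodule.neg_mem _ (hx trivial)
    have h := finrank_span_finset_le_card (R := ZMod p) (S.image φ)
    rw [Set.finrank, hspan, finrank_top, Module.finrank_fin_fun] at h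
    exact h.trans (Finset.card_image_le.trans hS.le)

end ZeroSumTheory

/-! Write `k` for the cross number, `v_g` for the multiplicity of `g`, and `d = min Δ(G₀)`. Suppose
`d` exceeds the bound, so that `d ≥ r` and `n ≤ 2d + 1`. Not all atoms have `k = 1`, since otherwise
lengths would be determined by `k`. Let `U` be an atom with `k(U) ≠ 1` and smallest support `X`.
Comparing `U` with the product of all `g ^ ord g`, `g ∈ X`, gives `|X| ≥ d + 2 ≥ r + 2`, and by
minimality every zero-sum sequence over `X` that misses an element of `X` is a product of atoms with
`k = 1` (a unit factorization). `IsCritical` records this situation; it forces `k(U) = 1`, a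
contradiction.

First, a rank argument (`mem_iSup_comap_closure`) yields sequences `B`, `B'` such that `B B'` is a
product of sequences `g ^ ord g` and both `B'` and `U B` have unit factorizations
(`IsCritical.exists_add_hasUnitFactorization`). Comparing lengths, an atom over `X` has `k = 1` or
`k ≥ 1 + d`. This gap and `ord g ≤ 2d + 1` allow each `g ^ ord g` to be cancelled from `U B B'`
without losing unit factorizability (`IsCritical.hasUnitFactorization_of_add_replicate`), and `U`
remains. -/

namespace ZeroSumTheory

/-! ### Torsion, rank and small generating sets -/

/-- A finite abelian group `A` has as many elements of `A / pA` as elements of order dividing `p`. -/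
lemma card_quotient_nsmul_range {A : Type*} [AddCommGroup A] [Finite A] (p : ℕ) :
    Nat.card (A ⧸ (nsmulAddMonoidHom p : A →+ A).range)
      = Nat.card (nsmulAddMonoidHom p : A →+ A).ker := by
  have h1 := (nsmulAddMonoidHom p : A →+ A).ker.card_mul_index
  have h2 := (nsmulAddMonoidHom p : A →+ A).range.index_mul_card
  rw [AddSubgroup.index_ker] at h1
  have h3 : 0 < Nat.card (nsmulAddMonoidHom p : A →+ A).range := Nat.card_pos
  rw [← h2] at h1
  exact (Nat.eq_of_mul_eq_mul_right h3 h1).symm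

lemma span_image_eq_top {A V : Type*} [AddCommGroup A] [AddCommGroup V] {p : ℕ}
    [Module (ZMod p) V] (f : A →+ V) (hf : Function.Surjective f) {S : Set A}
    (hS : AddSubgroup.closure S = ⊤) : Submodule.span (ZMod p) (f '' S) = ⊤ := by
  rw [eq_top_iff]
  intro y _
  obtain ⟨a, rfl⟩ := hf y
  have ha : a ∈ AddSubgroup.closure S := by rw [hS]; trivial
  have hle : AddSubgroup.closure S
      ≤ (Submodule.span (ZMod p) (f '' S)).toAddSubgroup.comap f :=
    (AddSubgroup.closure_le _).2 fun x hx => Submodule.subset_span ⟨x, hx, rfl⟩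
  exact hle ha

lemma quotient_nsmul_range_nsmul {A : Type*} [AddCommGroup A] (p : ℕ)
    (x : A ⧸ (nsmulAddMonoidHom p : A →+ A).range) : p • x = 0 := by
  induction x using QuotientAddGroup.induction_on with
  | H a =>
    rw [← QuotientAddGroup.mk_nsmul, QuotientAddGroup.eq_zero_iff]
    exact ⟨a, rfl⟩

lemma card_le_pow_card_of_span_eq_top {V : Type*} [AddCommGroup V] [Finite V] {p : ℕ}
    [Fact p.Prime] [Module (ZMod p) V] {S : Finset V}
    (hS : Submodule.span (ZMod p) (S : Set V) = ⊤) : Nat.card V ≤ p ^ S.card := by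
  have : Module.Finite (ZMod p) V := Module.Finite.of_finite
  rw [Module.natCard_eq_pow_finrank (K := ZMod p) (V := V), Nat.card_zmod]
  refine Nat.pow_le_pow_right (Fact.out : p.Prime).pos ?_
  have h := finrank_span_finset_le_card (R := ZMod p) S
  rwa [Set.finrank, hS, finrank_top] at h

lemma exists_finset_pow_card_eq_of_span_eq_top {V : Type*} [AddCommGroup V] [Finite V] {p : ℕ}
    [Fact p.Prime] [Module (ZMod p) V] {s : Set V} (hs : Submodule.span (ZMod p) s = ⊤) :
    ∃ t : Finset V, (t : Set V) ⊆ s ∧ p ^ t.card = Nat.card V ∧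
      Submodule.span (ZMod p) (t : Set V) = ⊤ := by
  have : Module.Finite (ZMod p) V := Module.Finite.of_finite
  obtain ⟨t, ht, htc, hts, -⟩ := Submodule.exists_finset_span_eq_linearIndepOn (ZMod p) s
  rw [hs] at htc hts
  rw [finrank_top] at htc
  exact ⟨t, ht, by rw [Module.natCard_eq_pow_finrank (K := ZMod p) (V := V), Nat.card_zmod, htc],
    hts⟩

/-- The `p`-torsion of a finite abelian group of rank `r` has at most `p ^ r` elements. -/
lemma card_ker_nsmul_le (G : Type*) [AddCommGroup G] [Finite G] {p : ℕ} (hp : p.Prime) :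
    Nat.card (nsmulAddMonoidHom p : G →+ G).ker ≤ p ^ AddGroup.rank G := by
  classical
  have : Fact p.Prime := ⟨hp⟩
  rw [← card_quotient_nsmul_range]
  let _ : Module (ZMod p) (G ⧸ (nsmulAddMonoidHom p : G →+ G).range) :=
    AddCommGroup.zmodModule (quotient_nsmul_range_nsmul p)
  obtain ⟨S, hS, hSt⟩ := AddGroup.rank_spec G
  have hspan := span_image_eq_top (p := p)
    (QuotientAddGroup.mk' (nsmulAddMonoidHom p : G →+ G).range)
    (QuotientAddGroup.mk'_surjective _) hSt
  rw [← Finset.coe_image] at hspan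
  exact (card_le_pow_card_of_span_eq_top hspan).trans
    (Nat.pow_le_pow_right hp.pos (Finset.card_image_le.trans hS.le))

/-- A generating set of a finite abelian group contains a small set which generates a subgroup of
index prime to `p`. -/
lemma exists_finset_closure_coprime_of_closure_eq_top {A : Type*} [AddCommGroup A] [Finite A]
    {p : ℕ} (hp : p.Prime) {T : Set A} (hT : AddSubgroup.closure T = ⊤) :
    ∃ E : Finset A, (E : Set A) ⊆ T ∧ p ^ E.card ≤ Nat.card (nsmulAddMonoidHom p : A →+ A).ker ∧
      ∃ s : ℕ, ¬ p ∣ s ∧ ∀ x : A, s • x ∈ AddSubgroup.closure (E : Set A) := by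
  classical
  have : Fact p.Prime := ⟨hp⟩
  rw [← card_quotient_nsmul_range]
  let _ : Module (ZMod p) (A ⧸ (nsmulAddMonoidHom p : A →+ A).range) :=
    AddCommGroup.zmodModule (quotient_nsmul_range_nsmul p)
  set π := QuotientAddGroup.mk' (nsmulAddMonoidHom p : A →+ A).range with hπ
  have hspan := span_image_eq_top (p := p) π (QuotientAddGroup.mk'_surjective _) hT
  obtain ⟨t, ht, htc, hts⟩ := exists_finset_pow_card_eq_of_span_eq_top hspan
  obtain ⟨E, hET, rfl, hEc⟩ : ∃ E : Finset A, (E : Set A) ⊆ T ∧ E.image π = t ∧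
      E.card = t.card := by
    choose! g hg using ht
    refine ⟨t.image g, ?_, ?_, ?_⟩
    · intro x hx
      obtain ⟨y, hy, rfl⟩ := Finset.mem_image.1 (Finset.mem_coe.1 hx)
      exact (hg hy).1
    · rw [Finset.image_image]
      ext y
      simp only [Finset.mem_image, Function.comp]
      constructor
      · rintro ⟨z, hz, rfl⟩; rwa [(hg hz).2]
      · exact fun hy => ⟨y, hy, (hg hy).2⟩
    · refine Finset.card_image_of_injOn fun x hx y hy hxy => ?_
      rw [← (hg hx).2, hxy, (hg hy).2]
  refine ⟨E, hET, ?_, ?_⟩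
  · rw [hEc, htc]
  set H := AddSubgroup.closure (E : Set A) with hH
  have hdiv : ∀ x : A, ∃ y ∈ H, ∃ z : A, x = y + p • z := by
    intro x
    have hx : π x ∈ Submodule.span (ZMod p) ((E.image π : Finset _) : Set _) := by
      rw [hts]; trivial
    have hle : ∀ q ∈ Submodule.span (ZMod p) ((E.image π : Finset _) : Set _),
        q ∈ H.map π := by
      intro q hq
      induction hq using Submodule.span_induction with
      | mem q hq =>
        obtain ⟨e, he, rfl⟩ := Finset.mem_image.1 (Finset.mem_coe.1 hq)
        exact ⟨e, AddSubgroup.subset_closure he, rfl⟩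
      | zero => exact zero_mem _
      | add x y _ _ hx hy => exact add_mem hx hy
      | smul a x _ hx =>
        rw [← ZMod.natCast_zmod_val a, Nat.cast_smul_eq_nsmul]
        exact nsmul_mem hx _
    obtain ⟨y, hy, hyx⟩ := hle _ hx
    have : -y + x ∈ (nsmulAddMonoidHom p : A →+ A).range := by
      rw [← QuotientAddGroup.eq]; exact hyx
    obtain ⟨z, hz⟩ := this
    refine ⟨y, hy, z, ?_⟩
    rw [show p • z = -y + x from hz]
    abel
  -- Since `A = H + pA`, multiplication by `p` is onto, hence injective, on `A ⧸ H`; by Cauchy's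
  -- theorem `p` does not divide its order.
  refine ⟨Nat.card (A ⧸ H), fun hdvd => ?_, fun x => ?_⟩
  · have hsurj : Function.Surjective (nsmulAddMonoidHom p : (A ⧸ H) →+ (A ⧸ H)) := by
      intro q
      induction q using QuotientAddGroup.induction_on with
      | H x =>
        obtain ⟨y, hy, z, rfl⟩ := hdiv x
        refine ⟨(z : A ⧸ H), ?_⟩
        change p • (z : A ⧸ H) = _
        rw [QuotientAddGroup.mk_add, (QuotientAddGroup.eq_zero_iff y).2 hy, zero_add,
          QuotientAddGroup.mk_nsmul]
    have hinj := Finite.injective_iff_surjective.2 hsurj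
    obtain ⟨q, hq⟩ := exists_prime_addOrderOf_dvd_card' p hdvd
    have h0 : p • q = 0 := hq ▸ addOrderOf_nsmul_eq_zero q
    have : q = 0 := hinj (by simpa using h0)
    rw [this, addOrderOf_zero] at hq
    exact hp.one_lt.ne hq
  · rw [← QuotientAddGroup.eq_zero_iff, QuotientAddGroup.mk_nsmul]
    simpa using card_nsmul_eq_zero' (x := (x : A ⧸ H))

/-- A subset of a finite abelian group `G` contains at most `rank G` elements which generate a
subgroup of index prime to `p` in the subgroup generated by the whole subset. -/
lemma exists_finset_closure_coprime {G : Type*} [AddCommGroup G] [Finite G]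
    {p : ℕ} (hp : p.Prime) (T : Set G) :
    ∃ E : Finset G, (E : Set G) ⊆ T ∧ E.card ≤ AddGroup.rank G ∧
      ∃ s : ℕ, ¬ p ∣ s ∧ ∀ x ∈ AddSubgroup.closure T, s • x ∈ AddSubgroup.closure (E : Set G) := by
  classical
  obtain ⟨E, hET, hE, s, hs, hsE⟩ := exists_finset_closure_coprime_of_closure_eq_top hp
    (AddSubgroup.closure_closure_coe_preimage (k := T))
  refine ⟨E.map (Function.Embedding.subtype _), ?_, ?_, s, hs, fun x hx => ?_⟩
  · intro x hx
    obtain ⟨y, hy, rfl⟩ := Finset.mem_map.1 (Finset.mem_coe.1 hx)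
    exact hET hy
  · rw [Finset.card_map]
    refine (Nat.pow_le_pow_iff_right hp.one_lt).1 (hE.trans (le_trans ?_ (card_ker_nsmul_le G hp)))
    refine Nat.card_le_card_of_injective
      (fun x => (⟨(x : AddSubgroup.closure T), ?_⟩ : (nsmulAddMonoidHom p : G →+ G).ker)) ?_
    · have := x.2
      rw [AddMonoidHom.mem_ker] at this ⊢
      exact congrArg Subtype.val this
    · intro x y hxy
      exact Subtype.ext (Subtype.ext (Subtype.mk.inj hxy))
  · have h := hsE ⟨x, hx⟩
    have hmap := AddSubgroup.mem_map_of_mem (AddSubgroup.closure T).subtype h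
    rw [AddMonoidHom.map_closure] at hmap
    simpa using hmap

/-- If a multiple of `h` lies in the subgroup generated by `T`, then its coefficient is a sum of
coefficients of multiples of `h` lying in subgroups generated by at most `rank G` elements
of `T`. -/
lemma mem_iSup_comap_closure {G : Type*} [AddCommGroup G] [Finite G] (T : Set G) (h : G) (z : ℤ)
    (hz : z • h ∈ AddSubgroup.closure T) :
    z ∈ ⨆ E : {E : Finset G // (E : Set G) ⊆ T ∧ E.card ≤ AddGroup.rank G},
      (AddSubgroup.closure ((E : Finset G) : Set G)).comap (zmultiplesHom G h) := by
  set J := ⨆ E : {E : Finset G // (E : Set G) ⊆ T ∧ E.card ≤ AddGroup.rank G},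
      (AddSubgroup.closure ((E : Finset G) : Set G)).comap (zmultiplesHom G h) with hJ
  -- Membership is tested prime by prime: for each `p`, some multiple `s • z` with `p ∤ s` lies in
  -- `J`, so `p` cannot divide the order of `z` modulo `J`.
  rw [← QuotientAddGroup.eq_zero_iff, ← AddMonoid.addOrderOf_eq_one_iff]
  by_contra hne
  obtain ⟨p, hp, hpd⟩ := Nat.exists_prime_and_dvd hne
  obtain ⟨E, hET, hE, s, hs, hsE⟩ := exists_finset_closure_coprime hp T
  refine hs (hpd.trans (addOrderOf_dvd_of_nsmul_eq_zero ?_))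
  rw [← QuotientAddGroup.mk_nsmul, QuotientAddGroup.eq_zero_iff]
  refine AddSubgroup.mem_iSup_of_mem (S := fun E : {E : Finset G // (E : Set G) ⊆ T ∧
    E.card ≤ AddGroup.rank G} => (AddSubgroup.closure ((E : Finset G) : Set G)).comap
      (zmultiplesHom G h)) ⟨E, hET, hE⟩ ?_
  rw [AddSubgroup.mem_comap, map_nsmul]
  exact hsE _ hz

/-! ### Sums of multisets -/

section Multisets

variable {G : Type*}

lemma le_sum_of_mem' {s : Multiset (Multiset G)} {A : Multiset G} (hA : A ∈ s) : A ≤ s.sum := by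
  obtain ⟨t, rfl⟩ := Multiset.exists_cons_of_mem hA
  rw [Multiset.sum_cons]
  exact Multiset.le_add_right _ _

lemma mem_of_mem_sum_replicate {t : Multiset G} {f : G → ℕ} {g : G}
    (hg : g ∈ (t.map fun g => Multiset.replicate (f g) g).sum) : g ∈ t := by
  induction t using Multiset.induction with
  | empty => simp at hg
  | cons a t ih =>
    rw [Multiset.map_cons, Multiset.sum_cons] at hg
    rcases Multiset.mem_add.1 hg with hg | hg
    · simp [Multiset.eq_of_mem_replicate hg]
    · simp [ih hg]

lemma mem_sum_of_mem {s : Multiset (Multiset G)} {A : Multiset G} (hA : A ∈ s) {g : G}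
    (hg : g ∈ A) : g ∈ s.sum :=
  Multiset.mem_of_le (le_sum_of_mem' hA) hg

lemma count_sum_multiset [DecidableEq G] (s : Multiset (Multiset G)) (g : G) :
    s.sum.count g = (s.map fun A => A.count g).sum := by
  induction s using Multiset.induction with
  | empty => simp
  | cons a s ih => simp [ih]

end Multisets

/-! ### Cross numbers and unit factorizations -/

section Factorizations

variable {G : Type*} [AddCommGroup G]

/-- A minimal zero-sum sequence: a nonempty zero-sum sequence without proper nonempty zero-sum
subsequences. -/
def IsMinZeroSum (A : Multiset G) : Prop :=
  A ≠ 0 ∧ A.sum = 0 ∧ ∀ B ≤ A, B.sum = 0 → B = 0 ∨ B = A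

/-- `C` is a product of minimal zero-sum sequences of cross number one. -/
def HasUnitFactorization (C : Multiset G) : Prop :=
  ∃ s : Multiset (Multiset G), (∀ A ∈ s, IsMinZeroSum A ∧ crossNumber A = 1) ∧ s.sum = C

@[simp] lemma crossNumber_zero : crossNumber (0 : Multiset G) = 0 := by simp [crossNumber]

@[simp] lemma crossNumber_add (A B : Multiset G) :
    crossNumber (A + B) = crossNumber A + crossNumber B := by simp [crossNumber]

lemma crossNumber_nonneg (A : Multiset G) : 0 ≤ crossNumber A := by
  refine Multiset.sum_nonneg fun x hx => ?_
  obtain ⟨g, -, rfl⟩ := Multiset.mem_map.1 hx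
  positivity

lemma crossNumber_sum (s : Multiset (Multiset G)) :
    crossNumber s.sum = (s.map crossNumber).sum := by
  induction s using Multiset.induction with
  | empty => simp
  | cons a s ih => simp [ih]

lemma crossNumber_sum_eq_card {s : Multiset (Multiset G)} (hs : ∀ A ∈ s, crossNumber A = 1) :
    crossNumber s.sum = s.card := by
  rw [crossNumber_sum, Multiset.map_congr rfl hs]
  simp

lemma crossNumber_replicate_addOrderOf [Finite G] (g : G) :
    crossNumber (Multiset.replicate (addOrderOf g) g) = 1 := by
  have : (addOrderOf g : ℚ) ≠ 0 := by exact_mod_cast (addOrderOf_pos g).ne'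
  simp [crossNumber, this]

lemma sum_eq_zero_of_forall_mem {s : Multiset (Multiset G)} (hs : ∀ A ∈ s, A.sum = 0) :
    s.sum.sum = 0 := by
  induction s using Multiset.induction with
  | empty => simp
  | cons a s ih =>
    rw [Multiset.sum_cons, Multiset.sum_add, hs a (by simp), ih fun A hA => hs A (by simp [hA]),
      zero_add]

/-- Every zero-sum sequence is a product of minimal zero-sum sequences. -/
lemma exists_factorization (C : Multiset G) (hC : C.sum = 0) :
    ∃ s : Multiset (Multiset G), (∀ A ∈ s, IsMinZeroSum A) ∧ s.sum = C := by
  induction C using Multiset.strongInductionOn with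
  | ih C ih =>
    by_cases h0 : C = 0
    · exact ⟨0, by simp, by simp [h0]⟩
    by_cases hmin : IsMinZeroSum C
    · exact ⟨{C}, by simpa using hmin, by simp⟩
    · obtain ⟨B, hBC, hB, hB0, hBne⟩ : ∃ B ≤ C, B.sum = 0 ∧ B ≠ 0 ∧ B ≠ C := by
        by_contra! hcon
        refine hmin ⟨h0, hC, fun B hBC hB => ?_⟩
        by_cases hB0 : B = 0
        exacts [Or.inl hB0, Or.inr (hcon B hBC hB hB0)]
      obtain ⟨B', rfl⟩ := Multiset.le_iff_exists_add.1 hBC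
      have hB' : B'.sum = 0 := by simpa [hB] using hC
      have hlt : B' < B + B' := lt_of_le_of_ne (Multiset.le_add_left _ _) fun h => hB0 (by
        simpa using h)
      obtain ⟨s, hs, rfl⟩ := ih B (lt_of_le_of_ne hBC hBne) hB
      obtain ⟨s', hs', rfl⟩ := ih B' hlt hB'
      refine ⟨s + s', fun A hA => ?_, by simp⟩
      rcases Multiset.mem_add.1 hA with h | h
      exacts [hs A h, hs' A h]

lemma HasUnitFactorization.add {B C : Multiset G} (hB : HasUnitFactorization B)
    (hC : HasUnitFactorization C) : HasUnitFactorization (B + C) := by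
  obtain ⟨s, hs, rfl⟩ := hB
  obtain ⟨s', hs', rfl⟩ := hC
  refine ⟨s + s', fun A hA => ?_, by simp⟩
  rcases Multiset.mem_add.1 hA with h | h
  exacts [hs A h, hs' A h]

lemma HasUnitFactorization.zero : HasUnitFactorization (0 : Multiset G) := ⟨0, by simp, by simp⟩

lemma HasUnitFactorization.sum_eq_zero {C : Multiset G} (hC : HasUnitFactorization C) :
    C.sum = 0 := by
  obtain ⟨s, hs, rfl⟩ := hC
  exact sum_eq_zero_of_forall_mem fun A hA => (hs A hA).1.2.1

lemma IsMinZeroSum.crossNumber_eq_one {A : Multiset G} (hA : IsMinZeroSum A)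
    (h : HasUnitFactorization A) : crossNumber A = 1 := by
  obtain ⟨s, hs, rfl⟩ := h
  induction s using Multiset.induction with
  | empty => exact absurd (by simp) hA.1
  | cons a s ih =>
    have ha := hs a (by simp)
    rcases hA.2.2 a (le_sum_of_mem' (by simp)) ha.1.2.1 with h | h
    · exact absurd h ha.1.1
    · rw [← h]; exact ha.2

end Factorizations

/-! ### Critical sets -/

section CriticalSets

variable {G : Type*} [AddCommGroup G] [Finite G]

/-- A finite set `X` with more than `rank G + 1` elements all of whose minimal zero-sum sequences
with support different from `X` have cross number one, and such that distinct lengths of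
factorizations over `X` differ by at least `d`. -/
structure IsCritical (X : Finset G) (d : ℕ) : Prop where
  one_le : ∀ A : Multiset G, IsMinZeroSum A → (∀ g ∈ A, g ∈ X) → 1 ≤ crossNumber A
  eq_one : ∀ A : Multiset G, IsMinZeroSum A → (∀ g ∈ A, g ∈ X) → (∃ g ∈ X, g ∉ A) →
    crossNumber A = 1
  le_sub : ∀ s s' : Multiset (Multiset G), (∀ A ∈ s, IsMinZeroSum A) →
    (∀ A ∈ s', IsMinZeroSum A) → s.sum = s'.sum → (∀ g ∈ s.sum, g ∈ X) → s.card < s'.card →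
    d ≤ s'.card - s.card
  rank_lt : AddGroup.rank G + 2 ≤ X.card
  addOrderOf_le : ∀ g : G, addOrderOf g ≤ 2 * d + 1

variable {X : Finset G} {d : ℕ}

lemma IsCritical.hasUnitFactorization_of_notMem (hX : IsCritical X d) {C : Multiset G}
    (hC : C.sum = 0) (hCX : ∀ g ∈ C, g ∈ X) (hg : ∃ g ∈ X, g ∉ C) : HasUnitFactorization C := by
  obtain ⟨s, hs, rfl⟩ := exists_factorization C hC
  obtain ⟨g, hgX, hg⟩ := hg
  exact ⟨s, fun A hA => ⟨hs A hA, hX.eq_one A (hs A hA) (fun g hg => hCX g (mem_sum_of_mem hA hg))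
    ⟨g, hgX, fun h => hg (mem_sum_of_mem hA h)⟩⟩, rfl⟩

variable [DecidableEq G]

/-- A zero-sum sequence with few distinct terms divides a product of sequences `g ^ ord g`, and the
multiplicity of one term can be prescribed. -/
lemma IsCritical.exists_complement_of_mem_closure (hX : IsCritical X d) {h : G} (hh : h ∈ X)
    {E : Finset G} (hE : (E : Set G) ⊆ {g | g ∈ X ∧ g ≠ h}) (hEr : E.card ≤ AddGroup.rank G)
    {z : ℤ} (hz : z • h ∈ AddSubgroup.closure (E : Set G)) :
    ∃ B B' t : Multiset G, HasUnitFactorization B ∧ HasUnitFactorization B' ∧ (∀ g ∈ t, g ∈ X) ∧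
      B + B' = (t.map fun g => Multiset.replicate (addOrderOf g) g).sum ∧
      (addOrderOf h : ℤ) ∣ (B.count h : ℤ) - z := by
  -- In a finite group the generated subgroup is the generated submonoid, so the coefficients can be
  -- taken nonnegative.
  have hz' : -(z • h) ∈ AddSubmonoid.closure (E : Set G) := by
    rw [← AddSubgroup.closure_toAddSubmonoid_of_finite]
    exact (AddSubgroup.closure (E : Set G)).neg_mem hz
  obtain ⟨b, -, hb⟩ := AddSubmonoid.mem_closure_finset.1 hz'
  have hpos : ∀ g : G, 0 < addOrderOf g := addOrderOf_pos
  have hhE : h ∉ E := fun hmem => (hE (Finset.mem_coe.2 hmem)).2 rfl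
  obtain ⟨x, hx⟩ : ∃ x : ℕ, (x : ℤ) = z % addOrderOf h :=
    ⟨_, Int.toNat_of_nonneg (Int.emod_nonneg _ (by exact_mod_cast (hpos h).ne'))⟩
  have hxlt : x < addOrderOf h := by
    have := Int.emod_lt_of_pos z (b := addOrderOf h) (by exact_mod_cast hpos h)
    omega
  have hxh : x • h = z • h := by
    rw [← natCast_zsmul, hx, mod_addOrderOf_zsmul]
  set c : G → ℕ := fun g => if g = h then x else b g % addOrderOf g with hc
  have hclt : ∀ g, c g ≤ addOrderOf g := fun g => by
    simp only [hc]
    split_ifs with hgh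
    · rw [hgh]; exact hxlt.le
    · exact (Nat.mod_lt _ (hpos g)).le
  set F := insert h E with hF
  have hFX : ∀ g ∈ F, g ∈ X := by
    intro g hg
    rcases Finset.mem_insert.1 hg with rfl | hg
    exacts [hh, (hE hg).1]
  -- As `|F| ≤ r + 1 < |X|`, every zero-sum sequence over `F` misses some `y ∈ X` and so has a unit
  -- factorization.
  obtain ⟨y, hyX, hyF⟩ : ∃ y ∈ X, y ∉ F := by
    refine Finset.exists_mem_notMem_of_card_lt_card ?_
    have h1 : F.card ≤ E.card + 1 := Finset.card_insert_le h E
    have h2 := hX.rank_lt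
    omega
  have hsum : ∀ (e : G → ℕ), (∑ g ∈ F, Multiset.replicate (e g) g).sum = ∑ g ∈ F, e g • g := by
    intro e
    rw [← Multiset.coe_sumAddMonoidHom, map_sum]
    simp
  have hmem : ∀ (e : G → ℕ), ∀ g ∈ ∑ g ∈ F, Multiset.replicate (e g) g, g ∈ F := by
    intro e g hg
    obtain ⟨g', hg', h'⟩ := Multiset.mem_sum.1 hg
    rwa [Multiset.eq_of_mem_replicate h']
  have hunit : ∀ (e : G → ℕ), ∑ g ∈ F, e g • g = 0 →
      HasUnitFactorization (∑ g ∈ F, Multiset.replicate (e g) g) := fun e he =>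
    hX.hasUnitFactorization_of_notMem ((hsum e).trans he) (fun g hg => hFX g (hmem e g hg))
      ⟨y, hyX, fun hy => hyF (hmem e y hy)⟩
  have hcsum : ∑ g ∈ F, c g • g = 0 := by
    rw [hF, Finset.sum_insert hhE]
    have : ∑ g ∈ E, c g • g = ∑ g ∈ E, b g • g := by
      refine Finset.sum_congr rfl fun g hg => ?_
      have hgh : g ≠ h := fun e => hhE (e ▸ hg)
      simp only [hc, if_neg hgh, mod_addOrderOf_nsmul]
    rw [this, hb]
    simp [hc, hxh]
  refine ⟨∑ g ∈ F, Multiset.replicate (c g) g, ∑ g ∈ F, Multiset.replicate (addOrderOf g - c g) g,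
    F.val, hunit _ hcsum, hunit _ ?_, fun g hg => hFX g hg, ?_, ?_⟩
  · have : ∑ g ∈ F, c g • g + ∑ g ∈ F, (addOrderOf g - c g) • g = 0 := by
      rw [← Finset.sum_add_distrib]
      refine Finset.sum_eq_zero fun g _ => ?_
      rw [← add_nsmul, Nat.add_sub_cancel' (hclt g), addOrderOf_nsmul_eq_zero]
    rwa [hcsum, zero_add] at this
  · rw [← Finset.sum_add_distrib]
    change _ = ∑ g ∈ F, _
    refine Finset.sum_congr rfl fun g _ => ?_
    rw [← Multiset.replicate_add, Nat.add_sub_cancel' (hclt g)]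
  · have : (∑ g ∈ F, Multiset.replicate (c g) g).count h = x := by
      rw [Multiset.count_sum', hF, Finset.sum_insert hhE, Finset.sum_eq_zero]
      · simp [hc]
      · intro g hg
        have hgh : g ≠ h := fun e => hhE (e ▸ hg)
        simp [Multiset.count_replicate, hgh]
    rw [this, hx]
    exact ⟨-(z / addOrderOf h), by linarith [Int.emod_add_mul_ediv z (addOrderOf h)]⟩

/-- The property is additive in `z`, so it passes from subsets of at most `r` elements to the
supremum in `mem_iSup_comap_closure`. -/
lemma IsCritical.exists_complement (hX : IsCritical X d) {h : G} (hh : h ∈ X) {z : ℤ}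
    (hz : z • h ∈ AddSubgroup.closure {g | g ∈ X ∧ g ≠ h}) :
    ∃ B B' t : Multiset G, HasUnitFactorization B ∧ HasUnitFactorization B' ∧ (∀ g ∈ t, g ∈ X) ∧
      B + B' = (t.map fun g => Multiset.replicate (addOrderOf g) g).sum ∧
      (addOrderOf h : ℤ) ∣ (B.count h : ℤ) - z := by
  refine AddSubgroup.iSup_induction _ (C := fun z : ℤ => ∃ B B' t : Multiset G,
    HasUnitFactorization B ∧ HasUnitFactorization B' ∧ (∀ g ∈ t, g ∈ X) ∧
      B + B' = (t.map fun g => Multiset.replicate (addOrderOf g) g).sum ∧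
      (addOrderOf h : ℤ) ∣ (B.count h : ℤ) - z) (mem_iSup_comap_closure _ h z hz) ?_ ?_ ?_
  · rintro ⟨E, hE, hEr⟩ w hw
    exact hX.exists_complement_of_mem_closure hh hE hEr hw
  · exact ⟨0, 0, 0, .zero, .zero, by simp, by simp, by simp⟩
  · rintro v w ⟨B₁, B₁', t₁, h₁, h₁', ht₁, e₁, d₁⟩ ⟨B₂, B₂', t₂, h₂, h₂', ht₂, e₂, d₂⟩
    refine ⟨B₁ + B₂, B₁' + B₂', t₁ + t₂, h₁.add h₂, h₁'.add h₂', fun g hg => ?_, ?_, ?_⟩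
    · rcases Multiset.mem_add.1 hg with hg | hg
      exacts [ht₁ g hg, ht₂ g hg]
    · rw [Multiset.map_add, Multiset.sum_add, ← e₁, ← e₂]
      abel
    · have := dvd_add d₁ d₂
      rw [Multiset.count_add]
      push_cast
      rwa [add_sub_add_comm]

/-- Every zero-sum sequence `U` over a critical set becomes a product of minimal zero-sum sequences
of cross number one after multiplication by a suitable divisor `B` of a product of sequences
`g ^ ord g`. -/
lemma IsCritical.exists_add_hasUnitFactorization (hX : IsCritical X d) {U : Multiset G}
    (hU : U.sum = 0) (hUX : ∀ g ∈ U, g ∈ X) :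
    ∃ B B' t : Multiset G, HasUnitFactorization B ∧ HasUnitFactorization B' ∧ (∀ g ∈ t, g ∈ X) ∧
      B + B' = (t.map fun g => Multiset.replicate (addOrderOf g) g).sum ∧
      HasUnitFactorization (U + B) := by
  have hcard := hX.rank_lt
  obtain ⟨h, hh⟩ : X.Nonempty := Finset.card_pos.1 (by omega)
  obtain ⟨h', hh', hne⟩ := Finset.exists_mem_ne (by omega : 1 < X.card) h
  have hUh : (-(U.count h : ℤ)) • h ∈ AddSubgroup.closure {g | g ∈ X ∧ g ≠ h} := by
    have hsplit := Multiset.filter_add_not (· = h) U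
    have hs : (U.count h) • h + (U.filter (¬ · = h)).sum = 0 := by
      rw [← hU]
      conv_rhs => rw [← hsplit]
      rw [Multiset.sum_add, Multiset.filter_eq', Multiset.sum_replicate]
    rw [neg_smul, natCast_zsmul, neg_eq_of_add_eq_zero_right hs]
    refine AddSubgroup.multiset_sum_mem _ _ fun g hg => AddSubgroup.subset_closure ?_
    rw [Multiset.mem_filter] at hg
    exact ⟨hUX g hg.1, hg.2⟩
  obtain ⟨B, B', t, hB, hB', ht, hBB', hdvd⟩ := hX.exists_complement hh hUh
  refine ⟨B, B', t, hB, hB', ht, hBB', ?_⟩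
  have hBX : ∀ g ∈ B, g ∈ X := by
    intro g hg
    have hmem : g ∈ (t.map fun g => Multiset.replicate (addOrderOf g) g).sum := by
      rw [← hBB']; exact Multiset.mem_add.2 (Or.inl hg)
    exact ht g (mem_of_mem_sum_replicate hmem)
  have hsum : (U + B).sum = 0 := by rw [Multiset.sum_add, hU, hB.sum_eq_zero, add_zero]
  have hUBX : ∀ g ∈ U + B, g ∈ X := by
    intro g hg
    rcases Multiset.mem_add.1 hg with hg | hg
    exacts [hUX g hg, hBX g hg]
  -- `B` was chosen so that `v_h(U B)` is a multiple of `ord h`. Hence `U B` splits into a zero-sum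
  -- power of `h` and a zero-sum sequence without `h`, each missing an element of `X`.
  have hdvd' : addOrderOf h ∣ (U + B).count h := by
    rw [← Int.natCast_dvd_natCast, Multiset.count_add]
    push_cast
    convert hdvd using 1
    ring
  have hh0 : (Multiset.replicate ((U + B).count h) h).sum = 0 := by
    rw [Multiset.sum_replicate]
    exact addOrderOf_dvd_iff_nsmul_eq_zero.1 hdvd'
  have hsplit := Multiset.filter_add_not (· = h) (U + B)
  rw [Multiset.filter_eq'] at hsplit
  rw [← hsplit]
  refine HasUnitFactorization.add ?_ ?_
  · refine hX.hasUnitFactorization_of_notMem hh0 (fun g hg => ?_) ⟨h', hh', fun hmem => ?_⟩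
    · rw [Multiset.eq_of_mem_replicate hg]; exact hh
    · exact hne (Multiset.eq_of_mem_replicate hmem)
  · refine hX.hasUnitFactorization_of_notMem ?_ (fun g hg => ?_) ⟨h, hh, fun hmem => ?_⟩
    · rw [← hsplit, Multiset.sum_add, hh0, zero_add] at hsum
      exact hsum
    · exact hUBX g (Multiset.mem_filter.1 hg).1
    · exact (Multiset.mem_filter.1 hmem).2 rfl

/-- With unit factorizations `s` of `B` and `s'` of `A B`, cross numbers give `k(A) - 1 = |s'| -
(|s| + 1)`. This is a difference of two lengths of `A B`, so it is at least `d` when positive. -/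
lemma IsCritical.crossNumber_eq_one_or_le (hX : IsCritical X d) {A : Multiset G}
    (hA : IsMinZeroSum A) (hAX : ∀ g ∈ A, g ∈ X) :
    crossNumber A = 1 ∨ 1 + (d : ℚ) ≤ crossNumber A := by
  rcases (hX.one_le A hA hAX).eq_or_lt with h | h
  · exact Or.inl h.symm
  right
  obtain ⟨B, B', t, ⟨s, hs, rfl⟩, -, ht, hBB', s', hs', hss'⟩ :=
    hX.exists_add_hasUnitFactorization hA.2.1 hAX
  have hcross := congrArg crossNumber hss'
  rw [crossNumber_add, crossNumber_sum_eq_card fun A hA => (hs A hA).2,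
    crossNumber_sum_eq_card fun A hA => (hs' A hA).2] at hcross
  have hlt : (A ::ₘ s).card < s'.card := by
    rw [Multiset.card_cons, ← Nat.cast_lt (α := ℚ)]
    push_cast
    linarith
  have hle := hX.le_sub (A ::ₘ s) s' (fun C hC => ?_) (fun C hC => (hs' C hC).1) (by simp [hss'])
    (fun g hg => ?_) hlt
  · have h2 : d + (s.card + 1) ≤ s'.card := by
      rw [Multiset.card_cons] at hle hlt
      omega
    have h3 : (d : ℚ) + (s.card + 1) ≤ s'.card := by exact_mod_cast h2
    linarith
  · rcases Multiset.mem_cons.1 hC with rfl | hC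
    exacts [hA, (hs C hC).1]
  · rw [Multiset.sum_cons] at hg
    rcases Multiset.mem_add.1 hg with hg | hg
    · exact hAX g hg
    have hmem : g ∈ (t.map fun g => Multiset.replicate (addOrderOf g) g).sum := by
      rw [← hBB']; exact Multiset.mem_add.2 (Or.inl hg)
    exact ht g (mem_of_mem_sum_replicate hmem)

lemma IsCritical.hasUnitFactorization_of_crossNumber_le (hX : IsCritical X d) {C : Multiset G}
    (hC : C.sum = 0) (hCX : ∀ g ∈ C, g ∈ X) (hd : crossNumber C ≤ d) :
    HasUnitFactorization C := by
  obtain ⟨s, hs, rfl⟩ := exists_factorization C hC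
  refine ⟨s, fun A hA => ⟨hs A hA, ?_⟩, rfl⟩
  refine (hX.crossNumber_eq_one_or_le (hs A hA)
    fun g hg => hCX g (mem_sum_of_mem hA hg)).resolve_right fun h => ?_
  obtain ⟨B, hB⟩ := Multiset.le_iff_exists_add.1 (le_sum_of_mem' hA)
  rw [hB, crossNumber_add] at hd
  linarith [crossNumber_nonneg B]

/-- Cancelling `g ^ ord g` preserves the existence of a unit factorization. -/
lemma IsCritical.hasUnitFactorization_of_add_replicate (hX : IsCritical X d) {C : Multiset G}
    {g : G} (hg : g ∈ X) (hCX : ∀ x ∈ C, x ∈ X)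
    (hC : HasUnitFactorization (C + Multiset.replicate (addOrderOf g) g)) :
    HasUnitFactorization C := by
  obtain ⟨s, hs, hsC⟩ := hC
  have hex : ∃ I, I ≤ s ∧ addOrderOf g ≤ I.sum.count g :=
    ⟨s, le_rfl, by rw [hsC]; simp⟩
  -- `I` is a minimal part of the factorization that still contains `g ^ ord g`; only the cofactor
  -- `Y` of `g ^ ord g` in `I` has to be refactored.
  obtain ⟨I, ⟨hIs, hIg⟩, hmin⟩ :=
    WellFounded.has_min (wellFounded_lt (α := Multiset (Multiset G)))
      {I | I ≤ s ∧ addOrderOf g ≤ I.sum.count g} hex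
  obtain ⟨J, rfl⟩ := Multiset.le_iff_exists_add.1 hIs
  obtain ⟨Y, hY⟩ := Multiset.le_iff_exists_add.1 (Multiset.le_count_iff_replicate_le.1 hIg)
  have hCY : C = Y + J.sum := by
    rw [Multiset.sum_add, hY] at hsC
    have : Multiset.replicate (addOrderOf g) g + C
        = Multiset.replicate (addOrderOf g) g + (Y + J.sum) := by
      rw [add_comm, ← hsC, add_assoc]
    exact add_left_cancel this
  have hIs' : ∀ A ∈ I, IsMinZeroSum A ∧ crossNumber A = 1 := fun A hA =>
    hs A (Multiset.mem_add.2 (Or.inl hA))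
  have hJ : HasUnitFactorization J.sum :=
    ⟨J, fun A hA => hs A (Multiset.mem_add.2 (Or.inr hA)), rfl⟩
  rw [hCY]
  refine HasUnitFactorization.add ?_ hJ
  have hYX : ∀ x ∈ Y, x ∈ X := fun x hx =>
    hCX x (by rw [hCY]; exact Multiset.mem_add.2 (Or.inl hx))
  have hY0 : Y.sum = 0 := by
    have h0 := sum_eq_zero_of_forall_mem fun A hA => (hIs' A hA).1.2.1
    rwa [hY, Multiset.sum_add, Multiset.sum_replicate, addOrderOf_nsmul_eq_zero, zero_add] at h0
  rcases hIg.eq_or_lt with heq | hlt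
  · refine hX.hasUnitFactorization_of_notMem hY0 hYX ⟨g, hg, ?_⟩
    rw [hY, Multiset.count_add, Multiset.count_replicate_self] at heq
    rw [← Multiset.count_eq_zero]
    omega
  · refine hX.hasUnitFactorization_of_crossNumber_le hY0 hYX ?_
    have herase : ∀ A ∈ I, (I.erase A).sum.count g < addOrderOf g ∧
        (I.erase A).sum.count g + A.count g = I.sum.count g := by
      intro A hA
      constructor
      · by_contra! hcon
        exact hmin (I.erase A) ⟨(Multiset.erase_le A I).trans hIs, hcon⟩
          (Multiset.erase_lt.2 hA)
      · rw [← Multiset.count_add, add_comm, ← Multiset.sum_cons, Multiset.cons_erase hA]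
    -- Removing one atom takes `v_g` from above `ord g` to below it. Hence `2(|I| - 1) < ord g ≤ 2d
    -- + 1`, and `k(Y) = |I| - 1 ≤ d` lies below the gap.
    have htwo : ∀ A ∈ I, 2 ≤ A.count g := fun A hA => by
      have := herase A hA
      omega
    obtain ⟨A, hA⟩ : ∃ A, A ∈ I := by
      refine Multiset.exists_mem_of_ne_zero fun h0 => ?_
      simp [h0] at hlt
    have hcard : 2 * (I.erase A).card ≤ (I.erase A).sum.count g := by
      rw [count_sum_multiset, mul_comm, ← smul_eq_mul]
      have := Multiset.card_nsmul_le_sum (s := (I.erase A).map fun A => A.count g) (a := 2) ?_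
      · simpa using this
      · intro x hx
        obtain ⟨A', hA', rfl⟩ := Multiset.mem_map.1 hx
        exact htwo A' (Multiset.mem_of_mem_erase hA')
    have hle := hX.addOrderOf_le g
    have hlt' := (herase A hA).1
    have hcard' := Multiset.card_erase_add_one hA
    have hI : I.card ≤ d + 1 := by omega
    have hcross := congrArg crossNumber hY
    rw [crossNumber_add, crossNumber_sum_eq_card fun A hA => (hIs' A hA).2,
      crossNumber_replicate_addOrderOf] at hcross
    have : (I.card : ℚ) ≤ d + 1 := by exact_mod_cast hI
    linarith

theorem IsCritical.crossNumber_eq_one (hX : IsCritical X d) {U : Multiset G}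
    (hU : IsMinZeroSum U) (hUX : ∀ g ∈ U, g ∈ X) : crossNumber U = 1 := by
  obtain ⟨B, B', t, -, hB', ht, hBB', hUB⟩ := hX.exists_add_hasUnitFactorization hU.2.1 hUX
  refine hU.crossNumber_eq_one ?_
  have h := hUB.add hB'
  rw [add_assoc, hBB'] at h
  clear hBB'
  induction t using Multiset.induction with
  | empty => simpa using h
  | cons g t ih =>
    refine ih (fun x hx => ht x (by simp [hx]))
      (hX.hasUnitFactorization_of_add_replicate (ht g (by simp)) ?_ ?_)
    · intro x hx
      rcases Multiset.mem_add.1 hx with hx | hx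
      · exact hUX x hx
      · exact ht x (by simp [mem_of_mem_sum_replicate hx])
    · rw [Multiset.map_cons, Multiset.sum_cons] at h
      convert h using 1
      abel

end CriticalSets

/-! ### Distances, and the reduction to critical sets -/

section Distances

variable {G : Type*} [AddCommGroup G] {G₀ : Set G}

lemma isAddUnit_zeroSumMonoid_iff (A : zeroSumMonoid G₀) :
    IsAddUnit A ↔ (A : Multiset G) = 0 := by
  constructor
  · intro h
    obtain ⟨B, hB⟩ := h.exists_neg
    have := congrArg Subtype.val hB
    exact (add_eq_zero.1 (this : (A : Multiset G) + B = 0)).1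
  · intro h
    rw [show A = 0 from Subtype.ext h]
    exact isAddUnit_zero

lemma addIrreducible_zeroSumMonoid_iff (A : zeroSumMonoid G₀) :
    AddIrreducible A ↔ IsMinZeroSum (A : Multiset G) := by
  constructor
  · intro h
    refine ⟨fun h0 => h.not_isAddUnit ((isAddUnit_zeroSumMonoid_iff A).2 h0), A.2.2,
      fun B hB hB0 => ?_⟩
    obtain ⟨C, hC⟩ := Multiset.le_iff_exists_add.1 hB
    have hA := A.2
    rw [hC] at hA
    have hC0 : C.sum = 0 := by simpa [hB0] using hA.2
    let B' : zeroSumMonoid G₀ := ⟨B, fun g hg => hA.1 g (Multiset.mem_add.2 (Or.inl hg)), hB0⟩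
    let C' : zeroSumMonoid G₀ := ⟨C, fun g hg => hA.1 g (Multiset.mem_add.2 (Or.inr hg)), hC0⟩
    rcases h.isAddUnit_or_isAddUnit (a := B') (b := C') (Subtype.ext hC) with h | h
    · exact Or.inl ((isAddUnit_zeroSumMonoid_iff B').1 h)
    · have : C = 0 := (isAddUnit_zeroSumMonoid_iff C').1 h
      rw [hC, this, add_zero]
      exact Or.inr rfl
  · rintro ⟨h0, -, h⟩
    refine ⟨fun hu => h0 ((isAddUnit_zeroSumMonoid_iff A).1 hu), fun B C hBC => ?_⟩
    have hBC' : (A : Multiset G) = B + C := congrArg Subtype.val hBC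
    rw [isAddUnit_zeroSumMonoid_iff, isAddUnit_zeroSumMonoid_iff]
    rcases h B (hBC' ▸ Multiset.le_add_right _ _) B.2.2 with h | h
    · exact Or.inl h
    · rw [← h] at hBC'
      exact Or.inr (by simpa using hBC')

lemma exists_mem_distances_le {L : Set ℕ} {a b : ℕ} (ha : a ∈ L) (hb : b ∈ L) (hab : a < b) :
    ∃ d ∈ distances L, d ≤ b - a := by
  classical
  have hex : ∃ c, c ∈ L ∧ a < c := ⟨b, hb, hab⟩
  obtain ⟨hc, hac⟩ := Nat.find_spec hex
  have hmin : ∀ c ∈ L, a < c → Nat.find hex ≤ c := fun c hc hac => Nat.find_min' hex ⟨hc, hac⟩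
  refine ⟨Nat.find hex - a, ⟨a, ha, _, hc, hac, ?_, rfl⟩, Nat.sub_le_sub_right (hmin b hb hab) a⟩
  ext x
  simp only [Set.mem_inter_iff, Set.mem_Icc, Set.mem_insert_iff, Set.mem_singleton_iff]
  constructor
  · rintro ⟨⟨hax, hxc⟩, hx⟩
    rcases hax.eq_or_lt with h | h
    exacts [Or.inl h.symm, Or.inr (le_antisymm hxc (hmin x hx h))]
  · rintro (rfl | rfl)
    exacts [⟨⟨le_rfl, hac.le⟩, ha⟩, ⟨⟨hac.le, le_rfl⟩, hc⟩]

lemma card_mem_lengthSet {s : Multiset (Multiset G)} (hs : ∀ A ∈ s, IsMinZeroSum A)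
    {B : zeroSumMonoid G₀} (hB : s.sum = B) : s.card ∈ lengthSet B := by
  have hmem : ∀ A ∈ s, A ∈ zeroSumMonoid G₀ := fun A hA =>
    ⟨fun g hg => B.2.1 g (hB ▸ mem_sum_of_mem hA hg), (hs A hA).2.1⟩
  refine ⟨s.pmap (fun A hA => ⟨A, hA⟩) hmem, fun u hu => ?_, Subtype.ext ?_, by simp⟩
  · obtain ⟨A, hA, rfl⟩ := Multiset.mem_pmap.1 hu
    exact (addIrreducible_zeroSumMonoid_iff _).2 (hs A hA)
  · rw [AddSubmonoid.coe_multiset_sum, ← hB, Multiset.map_pmap, Multiset.pmap_eq_map,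
      Multiset.map_id']

lemma sInf_setDistances_le {s s' : Multiset (Multiset G)} (hs : ∀ A ∈ s, IsMinZeroSum A)
    (hs' : ∀ A ∈ s', IsMinZeroSum A) (hss' : s.sum = s'.sum) (hsG : ∀ g ∈ s.sum, g ∈ G₀)
    (hlt : s.card < s'.card) : sInf (setDistances G₀) ≤ s'.card - s.card := by
  let B : zeroSumMonoid G₀ :=
    ⟨s.sum, hsG, sum_eq_zero_of_forall_mem fun A hA => (hs A hA).2.1⟩
  obtain ⟨d, hd, hle⟩ := exists_mem_distances_le (card_mem_lengthSet hs (B := B) rfl)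
    (card_mem_lengthSet hs' (B := B) hss'.symm) hlt
  exact (Nat.sInf_le (Set.mem_iUnion.2 ⟨B, hd⟩)).trans hle

lemma exists_crossNumber_ne_one (h : (setDistances G₀).Nonempty) :
    ∃ U : Multiset G, IsMinZeroSum U ∧ (∀ g ∈ U, g ∈ G₀) ∧ crossNumber U ≠ 1 := by
  by_contra! hcon
  obtain ⟨d, hd⟩ := h
  obtain ⟨B, a, ⟨s, hs, hsB, rfl⟩, b, ⟨s', hs', hs'B, rfl⟩, hlt, -⟩ := Set.mem_iUnion.1 hd
  have key : ∀ s : Multiset (zeroSumMonoid G₀), (∀ u ∈ s, AddIrreducible u) → s.sum = B →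
      (s.card : ℚ) = crossNumber (B : Multiset G) := by
    rintro s hs rfl
    rw [AddSubmonoid.coe_multiset_sum, crossNumber_sum_eq_card, Multiset.card_map]
    intro A hA
    obtain ⟨u, hu, rfl⟩ := Multiset.mem_map.1 hA
    exact hcon u ((addIrreducible_zeroSumMonoid_iff u).1 (hs u hu)) u.2.1
  have := (key s hs hsB).trans (key s' hs' hs'B).symm
  exact hlt.ne (by exact_mod_cast this)

variable [Finite G]

lemma isMinZeroSum_replicate_addOrderOf (g : G) :
    IsMinZeroSum (Multiset.replicate (addOrderOf g) g) := by
  refine ⟨fun h => ?_, by rw [Multiset.sum_replicate, addOrderOf_nsmul_eq_zero], fun B hB hB0 => ?_⟩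
  · have := congrArg Multiset.card h
    rw [Multiset.card_replicate, Multiset.card_zero] at this
    exact (addOrderOf_pos g).ne' this
  · obtain ⟨k, hk, rfl⟩ := Multiset.le_replicate_iff.1 hB
    rw [Multiset.sum_replicate] at hB0
    rcases Nat.eq_zero_or_pos k with rfl | hpos
    · exact Or.inl rfl
    · rw [le_antisymm hk (Nat.le_of_dvd hpos (addOrderOf_dvd_of_nsmul_eq_zero hB0))]
      exact Or.inr rfl

/-- If a minimal zero-sum sequence `U` over an LCN-set has cross number different from one, then
the least distance is at most `|supp U| - 2`. -/
lemma sInf_setDistances_add_two_le [DecidableEq G]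
    (hlcn : ∀ A : Multiset G, IsMinZeroSum A → (∀ g ∈ A, g ∈ G₀) → 1 ≤ crossNumber A)
    {U : Multiset G} (hU : IsMinZeroSum U) (hUG : ∀ g ∈ U, g ∈ G₀) (hU1 : crossNumber U ≠ 1) :
    sInf (setDistances G₀) + 2 ≤ U.toFinset.card := by
  -- Otherwise `U` would equal `g ^ ord g`, which has cross number one.
  have hlt : ∀ g, U.count g < addOrderOf g := by
    intro g
    by_contra! hle
    rcases hU.2.2 _ (Multiset.le_count_iff_replicate_le.1 hle)
      (isMinZeroSum_replicate_addOrderOf g).2.1 with h | h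
    · exact (isMinZeroSum_replicate_addOrderOf g).1 h
    · rw [← h, crossNumber_replicate_addOrderOf] at hU1
      exact hU1 rfl
  have hUsum : U = ∑ g ∈ U.toFinset, Multiset.replicate (U.count g) g := by
    conv_lhs => rw [← Multiset.toFinset_sum_count_nsmul_eq U]
    simp [Multiset.nsmul_singleton]
  set U' := ∑ g ∈ U.toFinset, Multiset.replicate (addOrderOf g - U.count g) g with hU'
  set s := U.toFinset.val.map fun g => Multiset.replicate (addOrderOf g) g with hs
  have hadd : U + U' = s.sum := by
    conv_lhs => rw [hUsum]
    rw [hU', ← Finset.sum_add_distrib]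
    change _ = ∑ g ∈ U.toFinset, _
    refine Finset.sum_congr rfl fun g _ => ?_
    rw [← Multiset.replicate_add, Nat.add_sub_cancel' (hlt g).le]
  have hsmin : ∀ A ∈ s, IsMinZeroSum A ∧ crossNumber A = 1 := by
    intro A hA
    obtain ⟨g, -, rfl⟩ := Multiset.mem_map.1 hA
    exact ⟨isMinZeroSum_replicate_addOrderOf g, crossNumber_replicate_addOrderOf g⟩
  have hsG : ∀ g ∈ U + U', g ∈ G₀ := by
    intro g hg
    rw [hadd, hs] at hg
    have := mem_of_mem_sum_replicate hg
    exact hUG g (by simpa using this)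
  have hU'0 : U'.sum = 0 := by
    have h0 := sum_eq_zero_of_forall_mem fun A hA => (hsmin A hA).1.2.1
    rwa [← hadd, Multiset.sum_add, hU.2.1, zero_add] at h0
  obtain ⟨s', hs', hs'U⟩ := exists_factorization U' hU'0
  have hs'pos : 0 < s'.card := by
    rw [Multiset.card_pos]
    rintro rfl
    obtain ⟨g, hg⟩ := Multiset.exists_mem_of_ne_zero hU.1
    have hcount : U'.count g = 0 := by rw [← hs'U]; simp
    have hcount' := congrArg (Multiset.count g) hadd
    rw [Multiset.count_add, hcount, add_zero] at hcount'
    have hle : Multiset.replicate (addOrderOf g) g ≤ s.sum :=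
      le_sum_of_mem' (Multiset.mem_map.2 ⟨g, by simpa using hg, rfl⟩)
    rw [← Multiset.le_count_iff_replicate_le, ← hcount'] at hle
    exact (hlt g).not_ge hle
  have hscard : s.card = U.toFinset.card := Multiset.card_map _ _
  have hcross := congrArg crossNumber hadd
  rw [crossNumber_add, crossNumber_sum_eq_card fun A hA => (hsmin A hA).2, ← hs'U,
    crossNumber_sum] at hcross
  have hge : (s'.card : ℚ) ≤ (s'.map crossNumber).sum := by
    have := Multiset.card_nsmul_le_sum (s := s'.map crossNumber) (a := 1) (fun x hx => by
      obtain ⟨A, hA, rfl⟩ := Multiset.mem_map.1 hx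
      exact hlcn A (hs' A hA) fun g hg => hsG g
        (Multiset.mem_add.2 (Or.inr (hs'U ▸ mem_sum_of_mem hA hg))))
    simpa using this
  have hUgt : 1 < crossNumber U := lt_of_le_of_ne (hlcn U hU hUG) hU1.symm
  -- All factors of `s` have `k = 1`, those of `s'` have `k ≥ 1`, and `k(U) > 1`. As `s'` is
  -- nonempty, the difference of lengths is at most `|supp U| - 2`.
  have hcardlt : (U ::ₘ s').card < s.card := by
    rw [Multiset.card_cons, ← Nat.cast_lt (α := ℚ)]
    push_cast
    linarith
  have hle := sInf_setDistances_le (G₀ := G₀) (s := U ::ₘ s') (s' := s) (fun A hA => ?_)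
    (fun A hA => (hsmin A hA).1) (by rw [Multiset.sum_cons, hs'U, hadd])
    (by rw [Multiset.sum_cons, hs'U]; exact hsG) hcardlt
  · rw [Multiset.card_cons] at hle hcardlt
    omega
  · rcases Multiset.mem_cons.1 hA with rfl | hA
    exacts [hU, hs' A hA]

/-- The least distance of a non-half-factorial LCN-set. -/
theorem IsLCN.sInf_setDistances_le (h : IsLCN G₀) (hne : (setDistances G₀).Nonempty) :
    sInf (setDistances G₀) ≤ max (AddGroup.rank G - 1) (AddMonoid.exponent G / 2 - 1) := by
  classical
  have hlcn : ∀ A : Multiset G, IsMinZeroSum A → (∀ g ∈ A, g ∈ G₀) → 1 ≤ crossNumber A :=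
    fun A hA hAG => h ⟨A, hAG, hA.2.1⟩ ((addIrreducible_zeroSumMonoid_iff _).2 hA)
  obtain ⟨U, ⟨hU, hUG, hU1⟩, hmin⟩ := exists_minimalFor_of_wellFoundedLT
    (fun U : Multiset G => IsMinZeroSum U ∧ (∀ g ∈ U, g ∈ G₀) ∧ crossNumber U ≠ 1)
    (fun U => U.toFinset.card) (exists_crossNumber_ne_one hne)
  by_contra! hlt
  obtain ⟨hr, hn⟩ := max_lt_iff.1 hlt
  have hsub : ∀ g ∈ U.toFinset, g ∈ G₀ := fun g hg => hUG g (Multiset.mem_toFinset.1 hg)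
  have hcrit : IsCritical U.toFinset (sInf (setDistances G₀)) :=
    { one_le := fun A hA hAU => hlcn A hA fun g hg => hsub g (hAU g hg)
      eq_one := by
        rintro A hA hAU ⟨g, hgU, hgA⟩
        by_contra hA1
        have hss : A.toFinset ⊂ U.toFinset := by
          refine (Finset.ssubset_iff_of_subset fun x hx => hAU x (Multiset.mem_toFinset.1 hx)).2
            ⟨g, hgU, fun hg => hgA (Multiset.mem_toFinset.1 hg)⟩
        have hc := Finset.card_lt_card hss
        exact hc.not_ge (hmin ⟨hA, fun x hx => hsub x (hAU x hx), hA1⟩ hc.le)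
      le_sub := fun s s' hs hs' hss' hsU hc =>
        ZeroSumTheory.sInf_setDistances_le hs hs' hss' (fun g hg => hsub g (hsU g hg)) hc
      rank_lt := by
        have := sInf_setDistances_add_two_le hlcn hU hUG hU1
        omega
      addOrderOf_le := fun g => by
        have hexp : 0 < AddMonoid.exponent G := AddMonoid.exponent_pos.2 .of_finite
        have := Nat.le_of_dvd hexp (AddMonoid.addOrder_dvd_exponent g)
        omega }
  exact hU1 (hcrit.crossNumber_eq_one hU fun g hg => Multiset.mem_toFinset.2 hg)

end Distances

end ZeroSumTheory

theorem proposition3p7 (G : Type*) [AddCommGroup G] [Finite G] (hG : 3 ≤ Nat.card G) :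
    ZeroSumTheory.m G ≤ max (AddGroup.rank G - 1) (AddMonoid.exponent G / 2 - 1) := by
  -- This form also covers the empty set, whose supremum in `ℕ` is `0`.
  refine csSup_le' ?_
  rintro d ⟨G₀, hlcn, hne, rfl⟩
  exact hlcn.sInf_setDistances_le hne
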